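/- Let $\mathcal S,\mathcal A$ be finite sets, and consider a discounted Markov decision process with transition probabilities $P(s'|s,a)$, reward function $r:\mathcal S\times\mathcal A\times\mathcal S\to\mathbb R$ and discount factor $\gamma\in(0,1)$. Let $\pi$ (target policy) and $\beta$ (behavior policy) be stochastic policies such that $\beta(a|s)=0$ implies $\pi(a|s)=0$. Let $d^\beta$ be a probability distribution on $\mathcal S$ with $d^\beta(s)>0$ for all $s$, let $D^\beta=\mathrm{diag}(d^\beta)$, and let $P^\pi(s,s')=\sum_{a}P(s'|s,a)\pi(a|s)$ and $R^\pi(s)=\sum_{a}\sum_{s'}\pi(a|s)P(s'|s,a)r(s,a,s')$. Let $\Phi\in\mathbb R^{|\mathcal S|\times q}$ have full column rank, let $\phi(s)\in\mathbb R^q$ be the transpose of its $s$-th row, and assume that the matrix $\Phi^TD^\beta(\gamma P^\pi-I)\Phi$ is nonsingular. Put $$\theta^*=-\bigl(\Phi^TD^\beta(\gamma P^\pi-I)\Phi\bigr)^{-1}\Phi^TD^\beta R^\pi .$$ Let the transitions $(s_k,a_k,s_k')$, $k\ge 0$, be independent and identically distributed with $s_k\sim d^\beta$, $a_k\sim\beta(\cdot|s_k)$,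 $s_k'\sim P(\cdot|s_k,a_k)$. Given arbitrary initial vectors $\theta_0,\lambda_0\in\mathbb R^q$, the algorithm GTD3 generates $$\theta_{k+1}=\theta_k+\alpha_k\bigl[(\phi_k-\gamma\rho_k\phi_k')(\phi_k^T\lambda_k)-\phi_k(\phi_k^T\theta_k)\bigr],\qquad \lambda_{k+1}=\lambda_k+\alpha_k\delta_k\phi_k,$$ where $\phi_k=\phi(s_k)$, $\phi_k'=\phi(s_k')$, $\rho_k=\pi(a_k|s_k)/\beta(a_k|s_k)$ and $\delta_k=\rho_k r(s_k,a_k,s_k')+\gamma\rho_k(\phi_k')^T\theta_k-\phi_k^T\theta_k$. Suppose that the step sizes are deterministic and satisfy $\alpha_k>0$, $\sum_{k=0}^\infty\alpha_k=\infty$ and $\sum_{k=0}^\infty\alpha_k^2<\infty$. Then $\theta^*$ is the unique solution $\theta\in\mathbb R^q$ of the projected Bellman equation $\Phi\theta=\Pi(R^\pi+\gamma P^\pi\Phi\theta)$, where $\Pi=\Phi(\Phi^TD^\beta\Phi)^{-1}\Phi^TD^\beta$, and $\theta_k\to\theta^*$ as $k\to\infty$ with probability one. -/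

import Mathlib

open Matrix MeasureTheory ProbabilityTheory Filter Topology

noncomputable section

/-- A discounted Markov decision process on the state space `S` and the action space `A`.
`P s a s'` is the transition probability from `s` to `s'` under the action `a`. -/
structure MDP (S A : Type*) [Fintype S] where
  P : S → A → S → ℝ
  r : S → A → S → ℝ
  γ : ℝ
  P_nonneg : ∀ s a s', 0 ≤ P s a s'
  P_sum : ∀ s a, ∑ s', P s a s' = 1
  γ_pos : 0 < γ
  γ_lt_one : γ < 1

/-- A stochastic policy: `prob s a` is the probability `π(a|s)` of the action `a` in state `s`. -/
structure Policy (S A : Type*) [Fintype A] where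
  prob : S → A → ℝ
  nonneg : ∀ s a, 0 ≤ prob s a
  sum_one : ∀ s, ∑ a, prob s a = 1

namespace MDP

variable {S A : Type*} [Fintype S] [Fintype A]

/-- The state transition matrix `P^π`. -/
def Ppi (M : MDP S A) (π : Policy S A) : Matrix S S ℝ :=
  Matrix.of fun s s' => ∑ a, M.P s a s' * π.prob s a

/-- The expected one-step reward vector `R^π`. -/
def Rpi (M : MDP S A) (π : Policy S A) : S → ℝ :=
  fun s => ∑ a, ∑ s', π.prob s a * M.P s a s' * M.r s a s'

variable [DecidableEq S] {q : ℕ}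

/-- The matrix `Φᵀ D (γ P^π - I) Φ`, where `D = diag d`. -/
def keyMatrix (M : MDP S A) (π : Policy S A) (d : S → ℝ) (Φ : Matrix S (Fin q) ℝ) :
    Matrix (Fin q) (Fin q) ℝ :=
  Φᵀ * Matrix.diagonal d * (M.γ • M.Ppi π - 1) * Φ

/-- `θ* = -(Φᵀ D (γ P^π - I) Φ)⁻¹ Φᵀ D R^π`. -/
def thetaStar (M : MDP S A) (π : Policy S A) (d : S → ℝ) (Φ : Matrix S (Fin q) ℝ) :
    Fin q → ℝ :=
  -((M.keyMatrix π d Φ)⁻¹ *ᵥ ((Φᵀ * Matrix.diagonal d) *ᵥ M.Rpi π))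

/-- The importance sampling ratio `π(a|s) / β(a|s)`. -/
def ratio (π β : Policy S A) (s : S) (a : A) : ℝ :=
  π.prob s a / β.prob s a

/-- The temporal difference `δ` at the parameter `θ` and the observed transition `(s, a, s')`:
`ρ r + γ ρ φ(s')ᵀ θ - φ(s)ᵀ θ`. The feature vector `φ(s)` is the row `Φ s`. -/
def tdError (M : MDP S A) (π β : Policy S A) (Φ : Matrix S (Fin q) ℝ)
    (x : S × A × S) (θ : Fin q → ℝ) : ℝ :=
  ratio π β x.1 x.2.1 * M.r x.1 x.2.1 x.2.2
    + M.γ * ratio π β x.1 x.2.1 * (Φ x.2.2 ⬝ᵥ θ) - Φ x.1 ⬝ᵥ θ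

/-- The pair `(θ_k, λ_k)` produced by GTD3 with step sizes `α` from the initial pair `init` along
the sequence `x k = (s_k, a_k, s_k')` of observed transitions. -/
def gtd3 (M : MDP S A) (π β : Policy S A) (Φ : Matrix S (Fin q) ℝ) (α : ℕ → ℝ)
    (init : (Fin q → ℝ) × (Fin q → ℝ)) (x : ℕ → S × A × S) :
    ℕ → (Fin q → ℝ) × (Fin q → ℝ)
  | 0 => init
  | k + 1 =>
    let θ := (gtd3 M π β Φ α init x k).1
    let lam := (gtd3 M π β Φ α init x k).2
    let φ := Φ (x k).1
    let φ' := Φ (x k).2.2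
    let ρ := ratio π β (x k).1 (x k).2.1
    (θ + α k • ((φ ⬝ᵥ lam) • (φ - (M.γ * ρ) • φ') - (φ ⬝ᵥ θ) • φ),
      lam + α k • (M.tdError π β Φ (x k) θ • φ))

/-- The transitions `X k = (s_k, a_k, s_k')` are independent, with `s_k ∼ d`,
`a_k ∼ β(·|s_k)` and `s_k' ∼ P(·|s_k, a_k)`. -/
structure IsIIDSample [MeasurableSpace S] [MeasurableSpace A] {Ω : Type*} [MeasurableSpace Ω]
    (M : MDP S A) (β : Policy S A) (d : S → ℝ) (μ : Measure Ω) (X : ℕ → Ω → S × A × S) :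
    Prop where
  measurable : ∀ k, Measurable (X k)
  indep : iIndepFun X μ
  law : ∀ k s a s', μ.real (X k ⁻¹' {(s, a, s')}) = d s * β.prob s a * M.P s a s'

end MDP

/-- The matrix `Φ (Φᵀ D Φ)⁻¹ Φᵀ D` of the projection onto the range of `Φ` with respect to the
norm `‖x‖_D = √(xᵀ D x)`, where `D = diag d`. -/
def projMatrix {S : Type*} [Fintype S] [DecidableEq S] {q : ℕ} (d : S → ℝ)
    (Φ : Matrix S (Fin q) ℝ) : Matrix S S ℝ :=
  Φ * (Φᵀ * Matrix.diagonal d * Φ)⁻¹ * Φᵀ * Matrix.diagonal d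

end

/-! Write K = Φᵀ D (γ P^π - I) Φ, C = Φᵀ D Φ and b = Φᵀ D R^π. Under the sampling law the mean GTD3
increment at (θ, λ) is (-Kᵀ λ - C θ, b + K θ), an affine saddle-point field with the single zero
(θ*, l'), where Kᵀ l' = -C θ* (`sum_sampleProb_smul_increment`). Around this zero, |x|² + |y|²
decreases only through x·Cx and gives no decay in y. Adding a small cross term 2ε y·Kx contributes
-ε|Kᵀy|², and invertibility of K makes the decay strict (`exists_saddleForm_dissipative`).

The resulting quadratic form V is a Lyapunov function for the random recursion itself. Increments
are affine and samples finite-valued, so one step changes the conditional mean of V by at most -cα_k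
V + Dα_k²(V + 1). Robbins–Siegmund (`ae_tendsto_lyapunov_zero`) then gives V → 0 almost surely, with
no prior boundedness of the iterates.

The Bellman part is algebra: Φ is injective and C invertible, so the projected equation is
equivalent to K θ = -b. -/

/-! ### Conditioning on the past of an independent sequence -/

/-- If `X` is finite-valued and independent of `m'`, and each `G x` is `m'`-measurable, then the
conditional expectation of `G X` given `m'` is obtained by averaging `G x` over the law of `X`. -/
theorem condExp_apply_of_indep {Ω E : Type*} [Fintype E] [MeasurableSpace E]
    [MeasurableSingletonClass E] {m' m : MeasurableSpace Ω} {μ : Measure[m] Ω}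
    [IsProbabilityMeasure μ] (hm : m' ≤ m) {X : Ω → E} (hX : Measurable[m] X)
    (hind : Indep (MeasurableSpace.comap X inferInstance) m' μ) {G : E → Ω → ℝ}
    (hG : ∀ x, StronglyMeasurable[m'] (G x)) (hGi : ∀ x, Integrable (G x) μ) :
    μ[fun ω => G (X ω) ω | m'] =ᵐ[μ] fun ω => ∑ x, μ.real (X ⁻¹' {x}) * G x ω := by
  classical
  set I : E → Ω → ℝ := fun x => (X ⁻¹' {x}).indicator 1 with hI
  have hmeas : ∀ x, MeasurableSet[m] (X ⁻¹' {x}) := fun x => hX (measurableSet_singleton x)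
  have hIi : ∀ x, Integrable (I x) μ := fun x =>
    (integrable_const (1 : ℝ)).indicator (hmeas x)
  have hGI : ∀ x, Integrable (G x * I x) μ := by
    intro x
    have : G x * I x = (X ⁻¹' {x}).indicator (G x) := by
      ext ω; simp [hI, Set.indicator_apply]
    rw [this]; exact (hGi x).indicator (hmeas x)
  -- Splitting along the values of `X` leaves products of an `m'`-measurable factor, which is pulled
  -- out, and an indicator independent of `m'`, whose conditional mean is constant.
  have hsum : (fun ω => G (X ω) ω) = ∑ x, G x * I x := by
    ext ω
    simp [hI, Set.indicator_apply]
  have hterm : ∀ x, μ[G x * I x | m'] =ᵐ[μ] fun ω => μ.real (X ⁻¹' {x}) * G x ω := by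
    intro x
    have h1 := condExp_mul_of_stronglyMeasurable_left (hG x) (hGI x) (hIi x)
    have hIm : StronglyMeasurable[MeasurableSpace.comap X inferInstance] (I x) :=
      by
      refine Measurable.stronglyMeasurable ?_
      exact Measurable.indicator (m := MeasurableSpace.comap X inferInstance) measurable_const
        ⟨{x}, measurableSet_singleton x, rfl⟩
    have h2 := condExp_indep_eq hX.comap_le hm hIm hind
    filter_upwards [h1, h2] with ω h1 h2
    rw [h1, Pi.mul_apply, h2, mul_comm]
    congr 1
    exact integral_indicator_one (hmeas x)
  rw [hsum]
  refine (condExp_finsetSum (fun x _ => hGI x) m').trans ?_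
  filter_upwards [eventually_countable_forall.2 hterm] with ω h
  simp [h]

/-- The filtration whose `k`-th member is generated by the variables `X j` with `j < k`. -/
def strictHistory {Ω E : Type*} [MeasurableSpace E] [m : MeasurableSpace Ω] (X : ℕ → Ω → E)
    (hX : ∀ k, Measurable (X k)) : Filtration ℕ m where
  seq k := ⨆ j ∈ Set.Iio k, MeasurableSpace.comap (X j) inferInstance
  mono' _ _ hij := biSup_mono fun _ hk => lt_of_lt_of_le hk hij
  le' _ := iSup₂_le fun j _ => (hX j).comap_le

theorem measurable_strictHistory {Ω E : Type*} [MeasurableSpace E] [MeasurableSpace Ω]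
    {X : ℕ → Ω → E} (hX : ∀ k, Measurable (X k)) {j k : ℕ} (hjk : j < k) :
    Measurable[strictHistory X hX k] (X j) := by
  rw [measurable_iff_comap_le]
  exact le_iSup₂_of_le (f := fun j (_ : j ∈ Set.Iio k) =>
    MeasurableSpace.comap (X j) inferInstance) j hjk le_rfl

/-- The history at `k` stops before `X k`, so it determines the iterate `Z k` of a recursion while
staying independent of the sample that drives the next step. -/
theorem indep_strictHistory {Ω E : Type*} [MeasurableSpace E] [MeasurableSpace Ω]
    {μ : Measure Ω} {X : ℕ → Ω → E} (hX : ∀ k, Measurable (X k)) (hind : iIndepFun X μ) (k : ℕ) :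
    Indep (MeasurableSpace.comap (X k) inferInstance) (strictHistory X hX k) μ := by
  have h := indep_iSup_of_disjoint (fun i => (hX i).comap_le) hind.iIndep
    (S := {k}) (T := Set.Iio k) (by simp)
  simpa [strictHistory] using h

/-! ### Robbins–Siegmund -/

/-- The deterministic part of the Robbins–Siegmund argument. -/
theorem tendsto_zero_of_tendsto_compensated {V c p : ℕ → ℝ} {P l : ℝ} (hV : ∀ k, 0 ≤ V k)
    (hc : ∀ k, 0 ≤ c k) (hp : Monotone p) (hp_one : ∀ k, 1 ≤ p k) (hP : ∀ k, p k ≤ P)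
    (hsum : Tendsto (fun n => ∑ k ∈ Finset.range n, c k) atTop atTop)
    (hU : Tendsto (fun k => (V k + 1) / p k + ∑ j ∈ Finset.range k, c j * V j / p (j + 1))
      atTop (𝓝 l)) :
    Tendsto V atTop (𝓝 0) := by
  have hp_pos : ∀ k, 0 < p k := fun k => zero_lt_one.trans_le (hp_one k)
  have hterm : ∀ j, 0 ≤ c j * V j / p (j + 1) := fun j =>
    div_nonneg (mul_nonneg (hc j) (hV j)) (hp_pos _).le
  obtain ⟨B, hB⟩ := hU.bddAbove_range
  have hS : Summable fun j => c j * V j / p (j + 1) := by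
    refine summable_of_sum_range_le (c := B) hterm fun n => ?_
    have h1 := hB ⟨n, rfl⟩
    have h2 : 0 ≤ (V n + 1) / p n := div_nonneg (by linarith [hV n]) (hp_pos n).le
    simp only at h1
    linarith
  -- The compensator converges, hence so does (V + 1)/p; the bounded monotone weight p converges
  -- too, so V has a limit.
  have hq := hU.sub hS.hasSum.tendsto_sum_nat
  simp only [add_sub_cancel_right] at hq
  have hpl := tendsto_atTop_ciSup hp ⟨P, by rintro _ ⟨k, rfl⟩; exact hP k⟩
  have hVl : Tendsto V atTop (𝓝 ((l - ∑' j, c j * V j / p (j + 1)) * (⨆ k, p k) - 1)) := by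
    refine ((hq.mul hpl).sub_const 1).congr fun k => ?_
    field_simp [(hp_pos k).ne']
    ring
  set v := (l - ∑' j, c j * V j / p (j + 1)) * (⨆ k, p k) - 1
  have hv : 0 ≤ v := ge_of_tendsto' hVl hV
  rcases hv.eq_or_lt with h0 | hpos
  · rwa [← h0] at hVl
  -- A positive limit v would give V > v/2 eventually, and summability of c V / p would force
  -- summability of c.
  exfalso
  have hev : ∀ᶠ k in atTop, v / 2 < V k := hVl.eventually_const_lt (by linarith)
  have hP0 : 0 < P := (hp_pos 0).trans_le (hP 0)
  have hcs : Summable c := by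
    refine (hS.mul_left (2 * P / v)).of_norm_bounded_eventually_nat ?_
    filter_upwards [hev] with k hk
    rw [Real.norm_of_nonneg (hc k), mul_div_assoc', le_div_iff₀ (hp_pos _), div_mul_eq_mul_div,
      le_div_iff₀ hpos]
    calc c k * p (k + 1) * v ≤ c k * P * (2 * V k) := by
          have := hc k
          have := hP (k + 1)
          gcongr
          linarith
      _ = 2 * P * (c k * V k) := by ring
  exact not_tendsto_atTop_of_tendsto_nhds hcs.hasSum.tendsto_sum_nat hsum

/-- **Robbins–Siegmund** for a recursion `Z (k+1) = f k (Z k) (X k)` driven by independent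
finite-valued variables `X k`, with Lyapunov function `V`. -/
theorem ae_tendsto_lyapunov_zero {Ω E F : Type*} [Fintype E] [MeasurableSpace E]
    [MeasurableSingletonClass E] [MeasurableSpace F] [MeasurableSpace Ω] {μ : Measure Ω}
    [IsProbabilityMeasure μ] {X : ℕ → Ω → E} (hX : ∀ k, Measurable (X k)) (hind : iIndepFun X μ)
    {p : E → ℝ} (hlaw : ∀ k x, μ.real (X k ⁻¹' {x}) = p x)
    {f : ℕ → F → E → F} (hf : ∀ k x, Measurable fun z => f k z x)
    {Z : ℕ → Ω → F} {z₀ : F} (hZ0 : ∀ ω, Z 0 ω = z₀)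
    (hZ : ∀ k ω, Z (k + 1) ω = f k (Z k ω) (X k ω))
    {V : F → ℝ} (hVm : Measurable V) (hV : ∀ z, 0 ≤ V z)
    {a c : ℕ → ℝ} (ha : ∀ k, 0 ≤ a k) (ha_sum : Summable a) (hc : ∀ k, 0 ≤ c k)
    (hc_sum : Tendsto (fun n => ∑ k ∈ Finset.range n, c k) atTop atTop)
    (hdrift : ∀ k z, ∑ x, p x * V (f k z x) ≤ V z - c k * V z + a k * (V z + 1)) :
    ∀ᵐ ω ∂μ, Tendsto (fun k => V (Z k ω)) atTop (𝓝 0) := by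
  have hp_sum : ∑ x, p x = 1 := by
    simp_rw [← hlaw 0]
    rw [sum_measureReal_preimage_singleton _ fun x _ => hX 0 (measurableSet_singleton x)]
    simp
  set ℱ := strictHistory X hX with hℱ
  have hZm : ∀ k, Measurable[ℱ k] (Z k) := by
    intro k
    induction k with
    | zero => rw [show Z 0 = fun _ => z₀ from funext hZ0]; exact measurable_const
    | succ k ih =>
      rw [show Z (k + 1) = fun ω => f k (Z k ω) (X k ω) from funext (hZ k)]
      have h1 : Measurable[ℱ (k + 1)] (Z k) := ih.mono (ℱ.mono k.le_succ) le_rfl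
      have h2 : Measurable[ℱ (k + 1)] (X k) := measurable_strictHistory hX k.lt_succ_self
      exact (measurable_from_prod_countable_left (f := fun y : F × E => f k y.1 y.2)
        (hf k)).comp (h1.prodMk h2)
  -- At a fixed time only finitely many values are reachable, which makes every integrability
  -- condition automatic.
  have hfin : ∀ k, (Set.range (Z k)).Finite := by
    intro k
    induction k with
    | zero => exact (Set.finite_singleton z₀).subset (by rintro _ ⟨ω, rfl⟩; exact hZ0 ω)
    | succ k ih =>
      refine (ih.image2 (f k) (Set.toFinite (Set.univ : Set E))).subset ?_
      rintro _ ⟨ω, rfl⟩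
      exact ⟨Z k ω, ⟨ω, rfl⟩, X k ω, trivial, (hZ k ω).symm⟩
  have hint : ∀ k (g : F → ℝ), Measurable g → Integrable (fun ω => g (Z k ω)) μ := by
    intro k g hg
    obtain ⟨C, hC⟩ := ((hfin k).image fun z => ‖g z‖).bddAbove
    refine Integrable.of_bound (hg.comp ((hZm k).mono (ℱ.le k) le_rfl)).aestronglyMeasurable C
      (Eventually.of_forall fun ω => hC ⟨_, ⟨ω, rfl⟩, rfl⟩)
  -- The drift bound reads E[V' + 1] ≤ (1 + a)(V + 1) - cV, so dividing V + 1 by this product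
  -- absorbs the growth; the subtracted terms cV are collected in `T`.
  set w : ℕ → ℝ := fun k => ∏ j ∈ Finset.range k, (1 + a j) with hw
  have hw_succ : ∀ k, w (k + 1) = w k * (1 + a k) := fun k => Finset.prod_range_succ _ _
  have hw_one : ∀ k, 1 ≤ w k := fun k => by
    induction k with
    | zero => simp [hw]
    | succ k ih => rw [hw_succ]; nlinarith [ha k]
  have hw_pos : ∀ k, 0 < w k := fun k => zero_lt_one.trans_le (hw_one k)
  have hw_mono : Monotone w := monotone_nat_of_le_succ fun k => by
    rw [hw_succ]; nlinarith [ha k, hw_pos k]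
  have hw_le : ∀ k, w k ≤ Real.exp (∑' j, a j) := fun k =>
    (Real.prod_one_add_le_exp_sum _ ha).trans
      (Real.exp_le_exp.2 (ha_sum.sum_le_tsum _ fun j _ => ha j))
  set T : ℕ → Ω → ℝ := fun k ω => ∑ j ∈ Finset.range k, c j * V (Z j ω) / w (j + 1) with hT
  set U : ℕ → Ω → ℝ := fun k ω => (V (Z k ω) + 1) / w k + T k ω with hU
  -- `T (i + 1)` involves only `Z 0, …, Z i` and is already known at time `i`: the compensator is
  -- predictable.
  have hTm : ∀ k i, k ≤ i + 1 → Measurable[ℱ i] (T k) := by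
    intro k i hki
    refine Finset.measurable_fun_sum _ fun j hj => ?_
    have : j ≤ i := by have := Finset.mem_range.1 hj; omega
    have hVj : Measurable[ℱ i] fun ω => V (Z j ω) :=
      hVm.comp ((hZm j).mono (ℱ.mono this) le_rfl)
    exact (hVj.const_mul _).div_const _
  have hTi : ∀ k, Integrable (T k) μ := fun k =>
    integrable_finsetSum _ fun j _ => ((hint j V hVm).const_mul _).div_const _
  have hUi : ∀ k, Integrable (U k) μ := fun k =>
    (((hint k V hVm).add (integrable_const 1)).div_const _).add (hTi k)
  have hsuper : Supermartingale U ℱ μ := by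
    refine supermartingale_nat (fun k => ?_) hUi fun k => ?_
    · have h1 : Measurable[ℱ k] fun ω => V (Z k ω) := hVm.comp (hZm k)
      exact (((h1.add_const 1).div_const _).add (hTm k k k.le_succ)).stronglyMeasurable
    · have hVf : ∀ x, Measurable fun z => V (f k z x) := fun x => hVm.comp (hf k x)
      have hce := condExp_apply_of_indep (ℱ.le k) (hX k) (indep_strictHistory hX hind k)
        (G := fun x ω => (V (f k (Z k ω) x) + 1) / w (k + 1) + T (k + 1) ω)
        (fun x => ((((hVf x).comp (hZm k)).add_const 1 |>.div_const _).add
          (hTm (k + 1) k le_rfl)).stronglyMeasurable)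
        (fun x => (((hint k _ (hVf x)).add (integrable_const 1)).div_const _).add (hTi _))
      have hUk : U (k + 1) =
          fun ω => (V (f k (Z k ω) (X k ω)) + 1) / w (k + 1) + T (k + 1) ω := by
        ext ω; simp only [hU, hZ]
      rw [hUk]
      filter_upwards [hce] with ω hω
      rw [hω]
      simp only [hlaw, mul_add, Finset.sum_add_distrib, ← Finset.sum_mul, hp_sum, one_mul,
        mul_div_assoc', mul_one, add_div, ← Finset.sum_div]
      have hT1 : T (k + 1) ω = T k ω + c k * V (Z k ω) / w (k + 1) :=
        Finset.sum_range_succ _ _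
      simp only [hU]
      rw [hT1]
      have hd := hdrift k (Z k ω)
      have key : (∑ x, p x * V (f k (Z k ω) x) + 1 + c k * V (Z k ω)) / w (k + 1)
          ≤ (V (Z k ω) + 1) / w k := by
        rw [div_le_div_iff₀ (hw_pos _) (hw_pos _), hw_succ]
        nlinarith [mul_le_mul_of_nonneg_right hd (hw_pos k).le]
      rw [add_div, add_div] at key
      linarith
  have hU_nonneg : ∀ k ω, 0 ≤ U k ω := fun k ω =>
    add_nonneg (div_nonneg (by linarith [hV (Z k ω)]) (hw_pos k).le)
      (Finset.sum_nonneg fun j _ => div_nonneg (mul_nonneg (hc j) (hV _)) (hw_pos _).le)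
  -- Nonnegativity turns the L¹ norm into the mean, which a supermartingale keeps below its initial
  -- value; Doob's convergence theorem then applies to `-U`.
  have hbdd : ∀ k, eLpNorm ((-U) k) 1 μ ≤ (∫ ω, U 0 ω ∂μ).toNNReal := by
    intro k
    rw [Pi.neg_apply, eLpNorm_neg, eLpNorm_one_eq_lintegral_enorm,
      ← ofReal_integral_norm_eq_lintegral_enorm (hUi k)]
    refine ENNReal.ofReal_le_ofReal ?_
    simp_rw [Real.norm_of_nonneg (hU_nonneg k _)]
    simpa using hsuper.setIntegral_le (Nat.zero_le k) MeasurableSet.univ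
  filter_upwards [hsuper.neg.exists_ae_tendsto_of_bdd hbdd] with ω ⟨l, hl⟩
  refine tendsto_zero_of_tendsto_compensated (fun k => hV (Z k ω)) hc hw_mono hw_one hw_le
    hc_sum (l := -l) ?_
  simpa using hl.neg

/-! ### Affine stochastic approximation -/

/-- Almost sure convergence of the stochastic approximation `Z (k+1) = Z k + α k • h (X k) (Z k)`
with affine increments, driven by i.i.d. finite-valued variables, when the mean increment is
strictly dissipative for an inner product `B`. -/
theorem ae_tendsto_affine_stochastic_approximation {Ω E F : Type*} [Fintype E] [MeasurableSpace E]
    [MeasurableSingletonClass E] [NormedAddCommGroup F] [NormedSpace ℝ F] [FiniteDimensional ℝ F]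
    [MeasurableSpace F] [BorelSpace F] [MeasurableSpace Ω] {μ : Measure Ω}
    [IsProbabilityMeasure μ] {X : ℕ → Ω → E} (hX : ∀ k, Measurable (X k)) (hind : iIndepFun X μ)
    {p : E → ℝ} (hlaw : ∀ k x, μ.real (X k ⁻¹' {x}) = p x)
    {h : E → F → F} (A : E → F →ₗ[ℝ] F) (b : E → F) (hh : ∀ x z, h x z = A x z + b x)
    {α : ℕ → ℝ} (hα : ∀ k, 0 < α k)
    (hα_sum : Tendsto (fun n => ∑ k ∈ Finset.range n, α k) atTop atTop)
    (hα_sq : Summable fun k => α k ^ 2)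
    {Z : ℕ → Ω → F} {z₀ : F} (hZ0 : ∀ ω, Z 0 ω = z₀)
    (hZ : ∀ k ω, Z (k + 1) ω = Z k ω + α k • h (X k ω) (Z k ω))
    (B : F →L[ℝ] F →L[ℝ] ℝ) (hB : ∀ u v, B u v = B v u)
    {m κ : ℝ} (hm : 0 < m) (hBm : ∀ u, m * ‖u‖ ^ 2 ≤ B u u) (hκ : 0 < κ) {z' : F}
    (hdiss : ∀ z, B (z - z') (∑ x, p x • h x z) ≤ -κ * ‖z - z'‖ ^ 2) :
    ∀ᵐ ω ∂μ, Tendsto (fun k => Z k ω) atTop (𝓝 z') := by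
  have hp_nonneg : ∀ x, 0 ≤ p x := fun x => by rw [← hlaw 0]; exact measureReal_nonneg
  have hp_sum : ∑ x, p x = 1 := by
    simp_rw [← hlaw 0]
    rw [sum_measureReal_preimage_singleton _ fun x _ => hX 0 (measurableSet_singleton x)]
    simp
  have hcont : ∀ x, Continuous (h x) := fun x => by
    rw [show h x = fun z => A x z + b x from funext (hh x)]
    exact (A x).continuous_of_finiteDimensional.add continuous_const
  obtain ⟨L, hL⟩ : ∃ L : ℝ, ∀ x z, ‖h x z‖ ≤ L * (1 + ‖z - z'‖) := by
    have hx : ∀ x, ∃ L : ℝ, ∀ z, ‖h x z‖ ≤ L * (1 + ‖z - z'‖) := fun x => by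
      refine ⟨‖(A x).toContinuousLinearMap‖ + ‖h x z'‖, fun z => ?_⟩
      have h1 : h x z = A x (z - z') + h x z' := by rw [hh, hh, map_sub]; abel
      have h2 := (A x).toContinuousLinearMap.le_opNorm (z - z')
      rw [LinearMap.coe_toContinuousLinearMap'] at h2
      have h3 := norm_add_le (A x (z - z')) (h x z')
      rw [← h1] at h3
      nlinarith [norm_nonneg (A x).toContinuousLinearMap, norm_nonneg (h x z'),
        norm_nonneg (z - z'), mul_nonneg (norm_nonneg (h x z')) (norm_nonneg (z - z'))]
    choose L hL using hx
    refine ⟨∑ x, |L x|, fun x z => (hL x z).trans ?_⟩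
    have : L x ≤ ∑ x, |L x| := (le_abs_self _).trans
      (Finset.single_le_sum (f := fun x => |L x|) (fun _ _ => abs_nonneg _) (Finset.mem_univ x))
    gcongr
  set V : F → ℝ := fun z => B (z - z') (z - z') with hVdef
  have hVm : Continuous V := by fun_prop
  have hV : ∀ z, 0 ≤ V z := fun z => le_trans (by positivity) (hBm (z - z'))
  have hVle : ∀ u, B u u ≤ ‖B‖ * ‖u‖ ^ 2 := fun u =>
    (le_abs_self _).trans ((B.le_opNorm₂ u u).trans_eq (by ring))
  -- The added 1 keeps the denominator positive when `F` is trivial and `B = 0`.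
  have hN : 0 < ‖B‖ + 1 := by positivity
  -- Comes from (1 + t)² ≤ 2 + 2t² with t = ‖z - z'‖ and t² ≤ V/m, after bounding the increment by
  -- L(1 + t).
  set D := ‖B‖ * (L ^ 2 * (2 + 2 / m)) with hD
  have hD0 : 0 ≤ D := by positivity
  have hdrift : ∀ k z, ∑ x, p x * V (z + α k • h x z)
      ≤ V z - (2 * κ / (‖B‖ + 1)) * α k * V z + D * α k ^ 2 * (V z + 1) := by
    intro k z
    have hexp : ∀ x, V (z + α k • h x z) =
        V z + 2 * α k * B (z - z') (h x z) + α k ^ 2 * B (h x z) (h x z) := by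
      intro x
      simp only [hVdef]
      rw [show z + α k • h x z - z' = (z - z') + α k • h x z by abel]
      simp only [map_add, map_smul, _root_.add_apply, _root_.smul_apply, smul_eq_mul]
      rw [hB (h x z) (z - z')]
      ring
    have hquad : ∀ x, B (h x z) (h x z) ≤ D * (V z + 1) := by
      intro x
      have h1 : ‖h x z‖ ^ 2 ≤ L ^ 2 * (1 + ‖z - z'‖) ^ 2 := by
        rw [← mul_pow]; exact pow_le_pow_left₀ (norm_nonneg _) (hL x z) 2
      have h2 : ‖z - z'‖ ^ 2 ≤ V z / m := by
        rw [le_div_iff₀ hm, mul_comm]; exact hBm _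
      have h3 : (1 + ‖z - z'‖) ^ 2 ≤ (2 + 2 / m) * (V z + 1) := by
        have h4 : 0 ≤ 2 / m := by positivity
        have h5 : (2 + 2 / m) * (V z + 1) = 2 * V z + 2 + 2 * (V z / m) + 2 / m := by ring
        rw [h5]
        nlinarith [sq_nonneg (1 - ‖z - z'‖), hV z]
      calc B (h x z) (h x z) ≤ ‖B‖ * ‖h x z‖ ^ 2 := hVle _
        _ ≤ ‖B‖ * (L ^ 2 * ((2 + 2 / m) * (V z + 1))) := by
            gcongr; exact h1.trans (by gcongr)
        _ = D * (V z + 1) := by rw [hD]; ring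
    have hlin : ∑ x, p x * B (z - z') (h x z) ≤ -(κ / (‖B‖ + 1)) * V z := by
      have h1 := hdiss z
      simp only [map_sum, map_smul, smul_eq_mul] at h1
      refine h1.trans ?_
      have h2 : V z ≤ (‖B‖ + 1) * ‖z - z'‖ ^ 2 :=
        (hVle _).trans (by gcongr; linarith)
      have h3 : κ / (‖B‖ + 1) * V z ≤ κ * ‖z - z'‖ ^ 2 := by
        rw [div_mul_eq_mul_div, div_le_iff₀ hN]
        calc κ * V z ≤ κ * ((‖B‖ + 1) * ‖z - z'‖ ^ 2) := by gcongr
          _ = _ := by ring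
      linarith
    calc ∑ x, p x * V (z + α k • h x z)
        = V z + 2 * α k * ∑ x, p x * B (z - z') (h x z)
          + α k ^ 2 * ∑ x, p x * B (h x z) (h x z) := by
          simp only [hexp, mul_add, Finset.sum_add_distrib, ← Finset.sum_mul, hp_sum, one_mul,
            Finset.mul_sum]
          congr 1
          · congr 1
            exact Finset.sum_congr rfl fun x _ => by ring
          · exact Finset.sum_congr rfl fun x _ => by ring
      _ ≤ V z + 2 * α k * (-(κ / (‖B‖ + 1)) * V z) + α k ^ 2 * (D * (V z + 1)) := by
          have h1 : ∑ x, p x * B (h x z) (h x z) ≤ D * (V z + 1) := by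
            calc _ ≤ ∑ x, p x * (D * (V z + 1)) :=
                  Finset.sum_le_sum fun x _ => mul_le_mul_of_nonneg_left (hquad x) (hp_nonneg x)
              _ = _ := by rw [← Finset.sum_mul, hp_sum, one_mul]
          have := (hα k).le
          gcongr
      _ = _ := by ring
  have hlim := ae_tendsto_lyapunov_zero (f := fun k z x => z + α k • h x z) hX hind hlaw
    (fun k x => (continuous_id.add ((hcont x).const_smul (α k))).measurable) hZ0 hZ
    hVm.measurable hV (a := fun k => D * α k ^ 2) (c := fun k => (2 * κ / (‖B‖ + 1)) * α k)
    (fun k => by positivity) (hα_sq.mul_left D) (fun k => by have := hα k; positivity)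
    (by
      simp_rw [← Finset.mul_sum]
      exact hα_sum.const_mul_atTop (by positivity)) hdrift
  filter_upwards [hlim] with ω hω
  rw [tendsto_iff_norm_sub_tendsto_zero]
  have h2 : Tendsto (fun k => ‖Z k ω - z'‖ ^ 2) atTop (𝓝 0) := by
    refine squeeze_zero (fun k => by positivity) (fun k => ?_) (by simpa using hω.div_const m)
    rw [le_div_iff₀ hm, mul_comm]
    exact hBm _
  simpa using h2.sqrt

/-! ### Quadratically homogeneous functions -/

section Homogeneous

variable {W : Type*} [NormedAddCommGroup W] [NormedSpace ℝ W]

theorem apply_eq_norm_sq_mul_of_homogeneous {f : W → ℝ}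
    (hf : ∀ (t : ℝ) x, f (t • x) = t ^ 2 * f x) {x : W} (hx : x ≠ 0) :
    f x = ‖x‖ ^ 2 * f (‖x‖⁻¹ • x) := by
  rw [← hf, smul_inv_smul₀ (norm_ne_zero_iff.2 hx)]

theorem inv_norm_smul_mem_sphere {x : W} (hx : x ≠ 0) : ‖x‖⁻¹ • x ∈ Metric.sphere (0 : W) 1 := by
  simp [norm_smul, norm_ne_zero_iff.2 hx]

/-- The constant is the minimum on the compact unit sphere; homogeneity extends the bound. The
sphere is empty when `W` is trivial, hence the case split. -/
theorem exists_pos_mul_norm_sq_le [FiniteDimensional ℝ W] {f : W → ℝ} (hc : Continuous f)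
    (hf : ∀ (t : ℝ) x, f (t • x) = t ^ 2 * f x) (hpos : ∀ x, x ≠ 0 → 0 < f x) :
    ∃ c, 0 < c ∧ ∀ x, c * ‖x‖ ^ 2 ≤ f x := by
  have hf0 : f 0 = 0 := by simpa using hf 0 0
  have := FiniteDimensional.proper_real W
  rcases (Metric.sphere (0 : W) 1).eq_empty_or_nonempty with he | hne
  · refine ⟨1, one_pos, fun x => ?_⟩
    have hx : x = 0 := by
      by_contra hx
      simpa [he] using inv_norm_smul_mem_sphere hx
    simp [hx, hf0]
  · obtain ⟨y, hy, hmin⟩ := (isCompact_sphere (0 : W) 1).exists_isMinOn hne hc.continuousOn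
    refine ⟨f y, hpos y (ne_zero_of_mem_unit_sphere ⟨y, hy⟩), fun x => ?_⟩
    rcases eq_or_ne x 0 with rfl | hx
    · simp [hf0]
    · rw [apply_eq_norm_sq_mul_of_homogeneous hf hx, mul_comm]
      exact mul_le_mul_of_nonneg_left (hmin (inv_norm_smul_mem_sphere hx)) (by positivity)

theorem exists_le_mul_norm_sq [FiniteDimensional ℝ W] {f : W → ℝ} (hc : Continuous f)
    (hf : ∀ (t : ℝ) x, f (t • x) = t ^ 2 * f x) :
    ∃ c, 0 ≤ c ∧ ∀ x, f x ≤ c * ‖x‖ ^ 2 := by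
  have hf0 : f 0 = 0 := by simpa using hf 0 0
  have := FiniteDimensional.proper_real W
  obtain ⟨c, hcb⟩ := ((isCompact_sphere (0 : W) 1).image hc).bddAbove
  refine ⟨max c 0, le_max_right _ _, fun x => ?_⟩
  rcases eq_or_ne x 0 with rfl | hx
  · simp [hf0]
  · rw [apply_eq_norm_sq_mul_of_homogeneous hf hx, mul_comm]
    exact mul_le_mul_of_nonneg_right
      ((hcb ⟨_, inv_norm_smul_mem_sphere hx, rfl⟩).trans (le_max_left _ _)) (by positivity)

end Homogeneous

/-! ### Lyapunov form of the saddle-point system -/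

/-- Here `‖x‖` is the sup norm, so the two sides differ in general. -/
theorem norm_sq_le_dotProduct_self {n : Type*} [Fintype n] (x : n → ℝ) : ‖x‖ ^ 2 ≤ x ⬝ᵥ x := by
  have h0 : 0 ≤ x ⬝ᵥ x := Finset.sum_nonneg fun i _ => mul_self_nonneg (x i)
  refine (Real.le_sqrt (norm_nonneg _) h0).1 ((pi_norm_le_iff_of_nonneg (Real.sqrt_nonneg _)).2
    fun i => Real.le_sqrt_of_sq_le ?_)
  rw [Real.norm_eq_abs, sq_abs, sq]
  exact Finset.single_le_sum (f := fun i => x i * x i) (fun i _ => mul_self_nonneg _)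
    (Finset.mem_univ i)

theorem abs_two_mul_dotProduct_le {n : Type*} [Fintype n] (x y : n → ℝ) :
    |2 * (x ⬝ᵥ y)| ≤ x ⬝ᵥ x + y ⬝ᵥ y := by
  have h1 : 0 ≤ (x + y) ⬝ᵥ (x + y) := Finset.sum_nonneg fun i _ => mul_self_nonneg _
  have h2 : 0 ≤ (x - y) ⬝ᵥ (x - y) := Finset.sum_nonneg fun i _ => mul_self_nonneg _
  simp only [dotProduct_add, add_dotProduct, dotProduct_sub, sub_dotProduct,
    dotProduct_comm y x] at h1 h2
  rw [abs_le]
  constructor <;> linarith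

/-- The bilinear form `x·x' + y·y' + ε (y·K x' + y'·K x)` on pairs of vectors. -/
noncomputable def saddleForm {n : Type*} [Fintype n] (K : Matrix n n ℝ) (ε : ℝ) :
    ((n → ℝ) × (n → ℝ)) →L[ℝ] ((n → ℝ) × (n → ℝ)) →L[ℝ] ℝ :=
  (LinearMap.mk₂ ℝ (fun z w : (n → ℝ) × (n → ℝ) =>
    z.1 ⬝ᵥ w.1 + z.2 ⬝ᵥ w.2 + ε * (z.2 ⬝ᵥ (K *ᵥ w.1) + w.2 ⬝ᵥ (K *ᵥ z.1)))
    (fun _ _ _ => by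
      simp only [Prod.fst_add, Prod.snd_add, add_dotProduct, mulVec_add, dotProduct_add]; ring)
    (fun _ _ _ => by
      simp only [Prod.smul_fst, Prod.smul_snd, smul_dotProduct, mulVec_smul, dotProduct_smul,
        smul_eq_mul]
      ring)
    (fun _ _ _ => by
      simp only [Prod.fst_add, Prod.snd_add, add_dotProduct, mulVec_add, dotProduct_add]; ring)
    (fun _ _ _ => by
      simp only [Prod.smul_fst, Prod.smul_snd, smul_dotProduct, mulVec_smul, dotProduct_smul,
        smul_eq_mul]
      ring)).toContinuousBilinearMap

theorem saddleForm_apply {n : Type*} [Fintype n] (K : Matrix n n ℝ) (ε : ℝ)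
    (z w : (n → ℝ) × (n → ℝ)) : saddleForm K ε z w =
      z.1 ⬝ᵥ w.1 + z.2 ⬝ᵥ w.2 + ε * (z.2 ⬝ᵥ (K *ᵥ w.1) + w.2 ⬝ᵥ (K *ᵥ z.1)) := rfl

theorem saddleForm_comm {n : Type*} [Fintype n] (K : Matrix n n ℝ) (ε : ℝ)
    (z w : (n → ℝ) × (n → ℝ)) : saddleForm K ε z w = saddleForm K ε w z := by
  rw [saddleForm_apply, saddleForm_apply, dotProduct_comm z.1, dotProduct_comm z.2 w.2]
  ring

/-- The linear saddle-point system `x' = -Kᵀ y - C x`, `y' = K x` with `K` invertible and `C`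
positive definite is strictly dissipative for `saddleForm K ε` with `ε` small. -/
theorem exists_saddleForm_dissipative {n : Type*} [Fintype n] [DecidableEq n]
    {K C : Matrix n n ℝ} (hK : IsUnit K) (hC : ∀ x, x ≠ 0 → 0 < x ⬝ᵥ (C *ᵥ x)) :
    ∃ ε m κ : ℝ, 0 < m ∧ 0 < κ ∧ (∀ z, m * ‖z‖ ^ 2 ≤ saddleForm K ε z z) ∧
      ∀ z, saddleForm K ε z (-(Kᵀ *ᵥ z.2) - C *ᵥ z.1, K *ᵥ z.1) ≤ -κ * ‖z‖ ^ 2 := by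
  obtain ⟨c, hc, hcC⟩ := exists_pos_mul_norm_sq_le (W := n → ℝ)
    (f := fun x => x ⬝ᵥ (C *ᵥ x)) (by fun_prop)
    (fun t x => by simp only [smul_dotProduct, mulVec_smul, dotProduct_smul, smul_eq_mul]; ring) hC
  obtain ⟨e, he, heK⟩ := exists_pos_mul_norm_sq_le (W := n → ℝ)
    (f := fun y => (Kᵀ *ᵥ y) ⬝ᵥ (Kᵀ *ᵥ y)) (by fun_prop)
    (fun t x => by simp only [smul_dotProduct, mulVec_smul, dotProduct_smul, smul_eq_mul]; ring)
    (fun y hy => by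
      have h1 : 0 ≤ (Kᵀ *ᵥ y) ⬝ᵥ (Kᵀ *ᵥ y) := Finset.sum_nonneg fun i _ => mul_self_nonneg _
      refine h1.lt_of_ne' fun h0 => hy ?_
      rw [dotProduct_self_eq_zero] at h0
      exact mulVec_injective_iff_isUnit.2 (by rwa [isUnit_transpose]) (h0.trans (mulVec_zero _).symm))
  obtain ⟨a, ha, haK⟩ := exists_le_mul_norm_sq (W := n → ℝ)
    (f := fun x => (K *ᵥ x) ⬝ᵥ (K *ᵥ x)) (by fun_prop)
    (fun t x => by simp only [smul_dotProduct, mulVec_smul, dotProduct_smul, smul_eq_mul]; ring)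
  obtain ⟨b, hb, hbC⟩ := exists_le_mul_norm_sq (W := n → ℝ)
    (f := fun x => (C *ᵥ x) ⬝ᵥ (C *ᵥ x)) (by fun_prop)
    (fun t x => by simp only [smul_dotProduct, mulVec_smul, dotProduct_smul, smul_eq_mul]; ring)
  have hnorm : ∀ z : (n → ℝ) × (n → ℝ), ‖z‖ ^ 2 ≤ ‖z.1‖ ^ 2 + ‖z.2‖ ^ 2 := fun z => by
    rcases max_choice ‖z.1‖ ‖z.2‖ with h | h <;> rw [Prod.norm_def, h] <;> nlinarith
  -- The bounds 1/2 on ε and εa keep the cross term below half of |x|² + |y|²; the last bound lets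
  -- the dissipation of `C` pay for the terms in x created by the cross term.
  obtain ⟨ε, hε, hε1, hεa, hεc⟩ :
      ∃ ε : ℝ, 0 < ε ∧ ε ≤ 1 / 2 ∧ ε * a ≤ 1 / 2 ∧ ε * (a + b) ≤ c / 2 := by
    have hden : 0 < 2 * (a + b + 1) := by positivity
    refine ⟨min c 1 / (2 * (a + b + 1)), by positivity, ?_, ?_, ?_⟩
    · rw [div_le_iff₀ hden]; nlinarith [min_le_right c 1]
    · rw [div_mul_eq_mul_div, div_le_iff₀ hden]
      nlinarith [min_le_right c 1, mul_le_mul_of_nonneg_right (min_le_right c 1) ha]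
    · rw [div_mul_eq_mul_div, div_le_iff₀ hden]
      nlinarith [mul_le_mul_of_nonneg_right (min_le_left c 1) (add_nonneg ha hb)]
  refine ⟨ε, 1 / 2, min (c / 2) (ε * e / 2), by norm_num, by positivity, ?_, ?_⟩
  · rintro ⟨x, y⟩
    refine (mul_le_mul_of_nonneg_left (hnorm (x, y)) (by norm_num)).trans ?_
    rw [saddleForm_apply]
    have h1 := (abs_le.1 (abs_two_mul_dotProduct_le y (K *ᵥ x))).1
    have h2 := haK x
    have h3 := norm_sq_le_dotProduct_self x
    have h4 := norm_sq_le_dotProduct_self y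
    have h5 := mul_le_mul_of_nonneg_left h1 hε.le
    have h6 := mul_le_mul_of_nonneg_left h2 hε.le
    have h7 := mul_le_mul_of_nonneg_right hεa (sq_nonneg ‖x‖)
    have h8 := mul_le_mul_of_nonneg_right hε1 ((sq_nonneg ‖y‖).trans h4)
    simp only at *
    nlinarith
  · rintro ⟨x, y⟩
    have hκ : min (c / 2) (ε * e / 2) * ‖(x, y)‖ ^ 2 ≤ c / 2 * ‖x‖ ^ 2 + ε * e / 2 * ‖y‖ ^ 2 := by
      refine (mul_le_mul_of_nonneg_left (hnorm (x, y)) (by positivity)).trans ?_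
      rw [mul_add]
      gcongr
      · exact min_le_left _ _
      · exact min_le_right _ _
    -- The skew terms -x·Kᵀy and y·Kx cancel, and the cross term supplies the missing -ε|Kᵀy|².
    have hsf : saddleForm K ε (x, y) (-(Kᵀ *ᵥ y) - C *ᵥ x, K *ᵥ x) =
        -(x ⬝ᵥ (C *ᵥ x)) + ε * ((K *ᵥ x) ⬝ᵥ (K *ᵥ x) - (Kᵀ *ᵥ y) ⬝ᵥ (Kᵀ *ᵥ y)
          - (Kᵀ *ᵥ y) ⬝ᵥ (C *ᵥ x)) := by
      have h1 : ∀ v, y ⬝ᵥ (K *ᵥ v) = (Kᵀ *ᵥ y) ⬝ᵥ v := fun v => by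
        rw [dotProduct_mulVec, mulVec_transpose]
      rw [saddleForm_apply]
      simp only [h1, dotProduct_sub, dotProduct_neg, dotProduct_comm x (Kᵀ *ᵥ y)]
      ring
    rw [hsf]
    have h1 := (abs_le.1 (abs_two_mul_dotProduct_le (Kᵀ *ᵥ y) (C *ᵥ x))).1
    have h2 := mul_le_mul_of_nonneg_left h1 hε.le
    have h3 := mul_le_mul_of_nonneg_left (haK x) hε.le
    have h4 := mul_le_mul_of_nonneg_left (hbC x) hε.le
    have h5 := mul_le_mul_of_nonneg_left (heK y) hε.le
    have h6 := mul_le_mul_of_nonneg_right hεc (sq_nonneg ‖x‖)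
    have h7 := hcC x
    have h8 := mul_nonneg (mul_nonneg hε.le hb) (sq_nonneg ‖x‖)
    nlinarith

/-! ### Normal equations and the projected Bellman equation -/

theorem mulVec_injective_of_rank_eq {m : Type*} [Fintype m] {q : ℕ} {Φ : Matrix m (Fin q) ℝ}
    (hΦ : Φ.rank = q) : Function.Injective Φ.mulVec := by
  rw [mulVec_injective_iff, linearIndependent_iff_card_eq_finrank_span, Set.finrank,
    ← rank_eq_finrank_span_cols, hΦ, Fintype.card_fin]

namespace MDP

theorem prob_mul_ratio {S A : Type*} [Fintype A] (π β : Policy S A)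
    (h_cover : ∀ s a, β.prob s a = 0 → π.prob s a = 0) (s : S)
    (a : A) :
    β.prob s a * ratio π β s a = π.prob s a := by
  by_cases h : β.prob s a = 0
  · rw [h, zero_mul, h_cover s a h]
  · exact mul_div_cancel₀ _ h

section Deterministic

variable {S A : Type*} [Fintype S] [Fintype A] {q : ℕ}
  (M : MDP S A) (π β : Policy S A) {d : S → ℝ} {Φ : Matrix S (Fin q) ℝ}

theorem keyMatrix_mulVec [DecidableEq S] (θ : Fin q → ℝ) :
    M.keyMatrix π d Φ *ᵥ θ = (Φᵀ * diagonal d) *ᵥ (M.γ • (M.Ppi π *ᵥ (Φ *ᵥ θ)) - Φ *ᵥ θ) := by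
  simp only [keyMatrix, ← mulVec_mulVec, sub_mulVec, smul_mulVec, one_mulVec]

theorem dotProduct_gram_mulVec [DecidableEq S] (x y : Fin q → ℝ) :
    x ⬝ᵥ ((Φᵀ * diagonal d * Φ) *ᵥ y) = ∑ s, d s * ((Φ *ᵥ x) s * (Φ *ᵥ y) s) := by
  rw [← mulVec_mulVec, ← mulVec_mulVec, dotProduct_mulVec, vecMul_transpose]
  simp only [dotProduct, mulVec_diagonal]
  exact Finset.sum_congr rfl fun s _ => by ring

theorem dotProduct_transpose_diagonal_mulVec [DecidableEq S] (x : Fin q → ℝ) (v : S → ℝ) :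
    x ⬝ᵥ ((Φᵀ * diagonal d) *ᵥ v) = ∑ s, d s * ((Φ *ᵥ x) s * v s) := by
  rw [← mulVec_mulVec, dotProduct_mulVec, vecMul_transpose]
  simp only [dotProduct, mulVec_diagonal]
  exact Finset.sum_congr rfl fun s _ => by ring

theorem dotProduct_keyMatrix_mulVec [DecidableEq S] (x y : Fin q → ℝ) :
    x ⬝ᵥ (M.keyMatrix π d Φ *ᵥ y) =
      M.γ * ∑ s, ∑ s', d s * M.Ppi π s s' * ((Φ *ᵥ x) s * (Φ *ᵥ y) s')
        - ∑ s, d s * ((Φ *ᵥ x) s * (Φ *ᵥ y) s) := by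
  rw [keyMatrix_mulVec, dotProduct_transpose_diagonal_mulVec, Finset.mul_sum,
    ← Finset.sum_sub_distrib]
  refine Finset.sum_congr rfl fun s _ => ?_
  simp only [Pi.sub_apply, Pi.smul_apply, smul_eq_mul, mul_sub]
  congr 1
  rw [show (M.Ppi π *ᵥ (Φ *ᵥ y)) s = ∑ s', M.Ppi π s s' * (Φ *ᵥ y) s' from rfl]
  simp only [Finset.mul_sum]
  exact Finset.sum_congr rfl fun s' _ => by ring

theorem dotProduct_gram_mulVec_pos [DecidableEq S] (hd : ∀ s, 0 < d s) (hΦ : Φ.rank = q) {x : Fin q → ℝ}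
    (hx : x ≠ 0) : 0 < x ⬝ᵥ ((Φᵀ * diagonal d * Φ) *ᵥ x) := by
  rw [dotProduct_gram_mulVec]
  have hne : Φ *ᵥ x ≠ 0 := fun h =>
    hx (mulVec_injective_of_rank_eq hΦ (h.trans (mulVec_zero _).symm))
  obtain ⟨s, hs⟩ := Function.ne_iff.1 hne
  exact Finset.sum_pos' (fun s _ => mul_nonneg (hd s).le (mul_self_nonneg _))
    ⟨s, Finset.mem_univ s, mul_pos (hd s) (mul_self_pos.2 hs)⟩

theorem isUnit_gram [DecidableEq S] (hd : ∀ s, 0 < d s) (hΦ : Φ.rank = q) :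
    IsUnit (Φᵀ * diagonal d * Φ) := by
  rw [← mulVec_injective_iff_isUnit]
  refine (injective_iff_map_eq_zero (mulVecLin (Φᵀ * diagonal d * Φ))).2 fun x hx => ?_
  by_contra hne
  have := dotProduct_gram_mulVec_pos hd hΦ hne
  rw [mulVecLin_apply] at hx
  rw [hx, dotProduct_zero] at this
  exact lt_irrefl _ this

/-- This linear equation links the two claims: it is the Bellman equation in coordinates and the
equilibrium condition of the λ-recursion. -/
theorem keyMatrix_mulVec_eq_neg_iff [DecidableEq S] (h : IsUnit (M.keyMatrix π d Φ)) (θ : Fin q → ℝ) :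
    M.keyMatrix π d Φ *ᵥ θ = -((Φᵀ * diagonal d) *ᵥ M.Rpi π) ↔ θ = M.thetaStar π d Φ := by
  rw [isUnit_iff_isUnit_det] at h
  constructor
  · intro hθ
    rw [thetaStar, ← mulVec_neg, ← hθ, mulVec_mulVec, nonsing_inv_mul _ h, one_mulVec]
  · rintro rfl
    rw [thetaStar, mulVec_neg, mulVec_mulVec, mul_nonsing_inv _ h, one_mulVec]

/-- `θ*` is the unique solution of the projected Bellman equation. -/
theorem projected_bellman_iff [DecidableEq S] (hd : ∀ s, 0 < d s) (hΦ : Φ.rank = q)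
    (h : IsUnit (M.keyMatrix π d Φ)) (θ : Fin q → ℝ) :
    Φ *ᵥ θ = projMatrix d Φ *ᵥ (M.Rpi π + M.γ • (M.Ppi π *ᵥ (Φ *ᵥ θ))) ↔
      θ = M.thetaStar π d Φ := by
  have hG := isUnit_gram hd hΦ
  have hdet := (isUnit_iff_isUnit_det _).1 hG
  set v := M.Rpi π + M.γ • (M.Ppi π *ᵥ (Φ *ᵥ θ)) with hv
  have h1 : projMatrix d Φ *ᵥ v =
      Φ *ᵥ ((Φᵀ * diagonal d * Φ)⁻¹ *ᵥ ((Φᵀ * diagonal d) *ᵥ v)) := by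
    simp only [projMatrix, mulVec_mulVec, Matrix.mul_assoc]
  -- Cancelling the injective Φ and multiplying by the Gram matrix gives the normal equations Φᵀ D Φ
  -- θ = Φᵀ D v.
  rw [← M.keyMatrix_mulVec_eq_neg_iff π h, h1, (mulVec_injective_of_rank_eq hΦ).eq_iff,
    ← (mulVec_injective_iff_isUnit.2 hG).eq_iff, mulVec_mulVec, mul_nonsing_inv _ hdet,
    one_mulVec, keyMatrix_mulVec, mulVec_sub, hv, mulVec_add, ← mulVec_mulVec θ (Φᵀ * diagonal d) Φ,
    eq_neg_iff_add_eq_zero, eq_comm, ← sub_eq_zero]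
  constructor <;> intro h <;> rw [← h] <;> abel

/-! ### Mean GTD3 increment -/

/-- The probability of the transition `(s, a, s')` under the sampling law. -/
def sampleProb (d : S → ℝ) (x : S × A × S) : ℝ :=
  d x.1 * β.prob x.1 x.2.1 * M.P x.1 x.2.1 x.2.2

theorem sum_sampleProb_mul (g : S → ℝ) :
    ∑ x, M.sampleProb β d x * g x.1 = ∑ s, d s * g s := by
  simp only [Fintype.sum_prod_type, sampleProb]
  refine Finset.sum_congr rfl fun s _ => ?_
  have h1 : ∀ a, ∑ s', d s * β.prob s a * M.P s a s' * g s = d s * g s * β.prob s a := fun a => by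
    rw [← Finset.sum_mul, ← Finset.mul_sum, M.P_sum]; ring
  simp only [h1, ← Finset.mul_sum, β.sum_one, mul_one]

/-- Importance sampling: β times the ratio is π, so summing over actions produces P^π. -/
theorem sum_sampleProb_mul_ratio (h_cover : ∀ s a, β.prob s a = 0 → π.prob s a = 0)
    (g : S → S → ℝ) :
    ∑ x, M.sampleProb β d x * (ratio π β x.1 x.2.1 * g x.1 x.2.2) =
      ∑ s, ∑ s', d s * M.Ppi π s s' * g s s' := by
  simp only [Fintype.sum_prod_type, sampleProb]
  refine Finset.sum_congr rfl fun s _ => ?_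
  rw [Finset.sum_comm]
  refine Finset.sum_congr rfl fun s' _ => ?_
  simp only [Ppi, of_apply, Finset.mul_sum, Finset.sum_mul]
  refine Finset.sum_congr rfl fun a _ => ?_
  rw [← prob_mul_ratio π β h_cover]
  ring

theorem sum_sampleProb_mul_reward (h_cover : ∀ s a, β.prob s a = 0 → π.prob s a = 0)
    (g : S → ℝ) :
    ∑ x, M.sampleProb β d x * (ratio π β x.1 x.2.1 * M.r x.1 x.2.1 x.2.2 * g x.1) =
      ∑ s, d s * (g s * M.Rpi π s) := by
  simp only [Fintype.sum_prod_type, sampleProb]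
  refine Finset.sum_congr rfl fun s _ => ?_
  simp only [Rpi, Finset.mul_sum]
  refine Finset.sum_congr rfl fun a _ => Finset.sum_congr rfl fun s' _ => ?_
  rw [← prob_mul_ratio π β h_cover]
  ring

/-- The increment direction of GTD3 at `z = (θ, λ)` for the observed transition `x`. -/
noncomputable def gtd3Increment (Φ : Matrix S (Fin q) ℝ) (x : S × A × S) (z : (Fin q → ℝ) × (Fin q → ℝ)) :
    (Fin q → ℝ) × (Fin q → ℝ) :=
  ((Φ x.1 ⬝ᵥ z.2) • (Φ x.1 - (M.γ * ratio π β x.1 x.2.1) • Φ x.2.2) - (Φ x.1 ⬝ᵥ z.1) • Φ x.1,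
    M.tdError π β Φ x z.1 • Φ x.1)

theorem gtd3_succ (Φ : Matrix S (Fin q) ℝ) (α : ℕ → ℝ) (init : (Fin q → ℝ) × (Fin q → ℝ))
    (x : ℕ → S × A × S) (k : ℕ) : M.gtd3 π β Φ α init x (k + 1) =
      M.gtd3 π β Φ α init x k + α k • M.gtd3Increment π β Φ (x k) (M.gtd3 π β Φ α init x k) := rfl

/-- The linear part of `gtd3Increment`. -/
noncomputable def gtd3IncrementLinear (Φ : Matrix S (Fin q) ℝ) (x : S × A × S) :
    (Fin q → ℝ) × (Fin q → ℝ) →ₗ[ℝ] (Fin q → ℝ) × (Fin q → ℝ) where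
  toFun z :=
    ((Φ x.1 ⬝ᵥ z.2) • (Φ x.1 - (M.γ * ratio π β x.1 x.2.1) • Φ x.2.2) - (Φ x.1 ⬝ᵥ z.1) • Φ x.1,
      (M.γ * ratio π β x.1 x.2.1 * (Φ x.2.2 ⬝ᵥ z.1) - Φ x.1 ⬝ᵥ z.1) • Φ x.1)
  map_add' z w := by
    ext i <;> simp only [Prod.fst_add, Prod.snd_add, dotProduct_add, Pi.add_apply, Pi.sub_apply,
      Pi.smul_apply, smul_eq_mul] <;> ring
  map_smul' t z := by
    ext i <;> simp only [Prod.smul_fst, Prod.smul_snd, dotProduct_smul, Pi.sub_apply,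
      Pi.smul_apply, smul_eq_mul, RingHom.id_apply] <;> ring

theorem gtd3Increment_eq_linear_add (x : S × A × S) (z : (Fin q → ℝ) × (Fin q → ℝ)) :
    M.gtd3Increment π β Φ x z = M.gtd3IncrementLinear π β Φ x z +
      (0, (ratio π β x.1 x.2.1 * M.r x.1 x.2.1 x.2.2) • Φ x.1) := by
  ext i <;> simp only [gtd3Increment, gtd3IncrementLinear, tdError, LinearMap.coe_mk,
    AddHom.coe_mk, Prod.fst_add, Prod.snd_add, Pi.add_apply, Pi.sub_apply, Pi.smul_apply,
    smul_eq_mul, Pi.zero_apply] <;> ring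

theorem sum_sampleProb_smul_increment [DecidableEq S] (h_cover : ∀ s a, β.prob s a = 0 → π.prob s a = 0)
    (z : (Fin q → ℝ) × (Fin q → ℝ)) :
    ∑ x, M.sampleProb β d x • M.gtd3Increment π β Φ x z =
      (-((M.keyMatrix π d Φ)ᵀ *ᵥ z.2) - (Φᵀ * diagonal d * Φ) *ᵥ z.1,
        (Φᵀ * diagonal d) *ᵥ M.Rpi π + M.keyMatrix π d Φ *ᵥ z.1) := by
  obtain ⟨θ, l⟩ := z
  have hΦ : ∀ s (v : Fin q → ℝ), Φ s ⬝ᵥ v = (Φ *ᵥ v) s := fun _ _ => rfl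
  refine Prod.ext ?_ ?_
  · simp only [Prod.fst_sum, Prod.smul_fst, gtd3Increment]
    -- Pairing with an arbitrary `w` turns the matrix identity into scalar sums over transitions.
    refine dotProduct_eq _ _ fun w => ?_
    rw [dotProduct_comm _ w, dotProduct_comm _ w]
    simp only [dotProduct_sum, dotProduct_smul, dotProduct_sub, dotProduct_neg, smul_eq_mul,
      dotProduct_comm w (Φ _), hΦ]
    rw [mulVec_transpose, dotProduct_comm w, ← dotProduct_mulVec, dotProduct_keyMatrix_mulVec,
      dotProduct_gram_mulVec, ← M.sum_sampleProb_mul_ratio π β h_cover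
        (fun s s' => (Φ *ᵥ l) s * (Φ *ᵥ w) s'),
      ← M.sum_sampleProb_mul β (fun s => (Φ *ᵥ l) s * (Φ *ᵥ w) s),
      ← M.sum_sampleProb_mul β (fun s => (Φ *ᵥ w) s * (Φ *ᵥ θ) s), Finset.mul_sum,
      ← Finset.sum_sub_distrib, ← Finset.sum_neg_distrib, ← Finset.sum_sub_distrib]
    exact Finset.sum_congr rfl fun x _ => by ring
  · simp only [Prod.snd_sum, Prod.smul_snd, gtd3Increment, tdError]
    refine dotProduct_eq _ _ fun w => ?_
    rw [dotProduct_comm _ w, dotProduct_comm _ w]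
    simp only [dotProduct_sum, dotProduct_smul, dotProduct_add, smul_eq_mul,
      dotProduct_comm w (Φ _), hΦ]
    rw [dotProduct_transpose_diagonal_mulVec, dotProduct_keyMatrix_mulVec,
      ← M.sum_sampleProb_mul_ratio π β h_cover (fun s s' => (Φ *ᵥ w) s * (Φ *ᵥ θ) s'),
      ← M.sum_sampleProb_mul β (fun s => (Φ *ᵥ w) s * (Φ *ᵥ θ) s),
      ← M.sum_sampleProb_mul_reward π β h_cover (fun s => (Φ *ᵥ w) s), Finset.mul_sum,
      ← Finset.sum_sub_distrib, ← Finset.sum_add_distrib]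
    exact Finset.sum_congr rfl fun x _ => by ring

end Deterministic

end MDP

/-! ### Conclusion -/

theorem mainTheorem1 {S A : Type*} [Fintype S] [DecidableEq S] [Fintype A]
    [MeasurableSpace S] [DiscreteMeasurableSpace S]
    [MeasurableSpace A] [DiscreteMeasurableSpace A]
    {Ω : Type*} [MeasurableSpace Ω] (μ : Measure Ω) [IsProbabilityMeasure μ]
    (M : MDP S A) (π β : Policy S A)
    (h_cover : ∀ s a, β.prob s a = 0 → π.prob s a = 0)
    (d : S → ℝ) (hd_pos : ∀ s, 0 < d s) (hd_sum : ∑ s, d s = 1)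
    {q : ℕ} (Φ : Matrix S (Fin q) ℝ) (hΦ : Φ.rank = q)
    (h_nonsing : IsUnit (M.keyMatrix π d Φ))
    (X : ℕ → Ω → S × A × S) (hX : M.IsIIDSample β d μ X)
    (α : ℕ → ℝ) (hα_pos : ∀ k, 0 < α k)
    (hα_sum : Tendsto (fun n => ∑ k ∈ Finset.range n, α k) atTop atTop)
    (hα_sq : Summable fun k => α k ^ 2)
    (θ₀ lam₀ : Fin q → ℝ) :
    (∀ θ : Fin q → ℝ,
      Φ *ᵥ θ = projMatrix d Φ *ᵥ (M.Rpi π + M.γ • (M.Ppi π *ᵥ (Φ *ᵥ θ))) ↔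
        θ = M.thetaStar π d Φ) ∧
    ∀ᵐ ω ∂μ, Tendsto
      (fun k => (M.gtd3 π β Φ α (θ₀, lam₀) (fun j => X j ω) k).1)
      atTop (𝓝 (M.thetaStar π d Φ)) := by
  refine ⟨M.projected_bellman_iff π hd_pos hΦ h_nonsing, ?_⟩
  set K := M.keyMatrix π d Φ with hK
  set C := Φᵀ * diagonal d * Φ with hC
  set θ' := M.thetaStar π d Φ with hθ'
  obtain ⟨ε, m, κ, hm, hκ, hcoer, hdiss⟩ := exists_saddleForm_dissipative h_nonsing
    (C := C) fun x hx => MDP.dotProduct_gram_mulVec_pos hd_pos hΦ hx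
  have hKθ : K *ᵥ θ' = -((Φᵀ * diagonal d) *ᵥ M.Rpi π) :=
    (M.keyMatrix_mulVec_eq_neg_iff π h_nonsing θ').2 rfl
  -- The limit of λ, chosen to annihilate the θ-component of the mean field at θ*; it need not
  -- vanish.
  set l' : Fin q → ℝ := -(Kᵀ⁻¹ *ᵥ (C *ᵥ θ')) with hl'
  have hKl : Kᵀ *ᵥ l' = -(C *ᵥ θ') := by
    have hdet : IsUnit Kᵀ.det := (isUnit_iff_isUnit_det _).1 (by rwa [isUnit_transpose])
    rw [hl', mulVec_neg, mulVec_mulVec, mul_nonsing_inv _ hdet, one_mulVec]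
  have hlim := ae_tendsto_affine_stochastic_approximation hX.measurable hX.indep
    (p := M.sampleProb β d) (fun k x => hX.law k x.1 x.2.1 x.2.2)
    (M.gtd3IncrementLinear π β Φ) _ (M.gtd3Increment_eq_linear_add π β) hα_pos hα_sum hα_sq
    (Z := fun k ω => M.gtd3 π β Φ α (θ₀, lam₀) (fun j => X j ω) k) (fun _ => rfl)
    (fun k ω => M.gtd3_succ π β Φ α _ _ k) (saddleForm K ε) (saddleForm_comm K ε) hm hcoer hκ
    (z' := (θ', l')) (fun z => by
      -- Recentring at the equilibrium removes the constant term and leaves the linear saddle-point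
      -- field.
      convert hdiss (z - (θ', l')) using 2
      rw [M.sum_sampleProb_smul_increment π β h_cover, Prod.fst_sub, Prod.snd_sub, mulVec_sub,
        mulVec_sub, mulVec_sub, hKθ, hKl]
      refine Prod.ext ?_ ?_
      · simp only; abel
      · simp only; abel)
  filter_upwards [hlim] with ω hω
  exact (continuous_fst.tendsto _).comp hω
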